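/- Let $d\ge 1$ be an integer and let $\mathbf r=(r_1,\dots,r_d)\colon\mathbb N\to(0,\tfrac12)^d$, where $\mathbb N=\{1,2,3,\dots\}$. For $x\in\mathbb R$ let $\|x\|$ be the distance from $x$ to the nearest integer, let $|\mathbf t|_\infty=\max_i|t_i|$, and for a real $d\times d$ matrix $M$ let $\sigma(M)=\inf\{\|M\mathbf x\|_2:\|\mathbf x\|_2=1\}$ be its smallest singular value. Let $\mu$ be a Borel probability measure on $[0,1)^d$ and put $\widehat\mu(\mathbf t)=\int e^{-2\pi i\langle\mathbf t,\mathbf x\rangle}\,d\mu(\mathbf x)$ for $\mathbf t\in\mathbb R^d$. Let $\mathcal A=(A_n)_{n\ge1}$ be a sequence of integral $d\times d$ matrices and let $A_0$ be the $d\times d$ identity matrix. Assume that for some $K>1$ $$\sigma(A_{n+1}A_n^{-1})\ge K\qquad(n\ge0)$$ (in particular, all $A_n$ are invertible over $\mathbb R$), and that there exists $s>d+1$ such that $$\widehat\mu(\mathbf t)=O\big((\log|\mathbf t|_\infty)^{-s}\big)\qquad\text{as }|\mathbf t|_\infty\to\infty.$$ For $n\in\mathbb N$ let $\mathcal R_n(\mathbf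 r)=\{\mathbf x\in[0,1)^d:\|x_i\|\le r_i(n),\ 1\le i\le d\}$, and for $\boldsymbol\alpha\in[0,1)^d$ let $$\mathcal T_{\boldsymbol\alpha}(\mathcal A,\mathbf r)=\big\{\boldsymbol\beta\in[0,1)^d: A_n\boldsymbol\alpha\in\boldsymbol\beta+\mathcal R_n(\mathbf r)\ (\mathrm{mod}\ 1)\text{ for infinitely many }n\in\mathbb N\big\},$$ where $(\mathrm{mod}\ 1)$ means modulo $\mathbb Z^d$. Then, for $\mu$-almost every $\boldsymbol\alpha$, the $d$-dimensional Lebesgue measure of $\mathcal T_{\boldsymbol\alpha}(\mathcal A,\mathbf r)$ is $$\mathcal L^d\big(\mathcal T_{\boldsymbol\alpha}(\mathcal A,\mathbf r)\big)=\begin{cases}0,&\text{if }\sum_{n=1}^\infty\prod_{i=1}^d r_i(n)<\infty,\\[1mm] 1,&\text{if }\sum_{n=1}^\infty\prod_{i=1}^d r_i(n)=\infty.\end{cases}$$ -/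

import Mathlib

noncomputable section

namespace TwistedApprox

/-- The half-open unit cube `[0,1)^d`. -/
def unitCube (d : ℕ) : Set (Fin d → ℝ) :=
  Set.univ.pi fun _ => Set.Ico (0 : ℝ) 1

/-- The distance from a real number to the nearest integer. -/
def distInt (x : ℝ) : ℝ := |x - (round x : ℝ)|

/-- The smallest singular value `inf { ‖M x‖₂ : ‖x‖₂ = 1 }` of a real square matrix. -/
def smallestSingularValue {d : ℕ} (M : Matrix (Fin d) (Fin d) ℝ) : ℝ :=
  sInf ((fun x : EuclideanSpace ℝ (Fin d) => ‖Matrix.toEuclideanLin M x‖) ''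
    {x : EuclideanSpace ℝ (Fin d) | ‖x‖ = 1})

/-- An integral matrix, regarded as a real matrix. -/
def realMat {d : ℕ} (M : Matrix (Fin d) (Fin d) ℤ) : Matrix (Fin d) (Fin d) ℝ :=
  M.map (fun a : ℤ => (a : ℝ))

/-- The Fourier transform `∫ exp (-2πi ⟨t, x⟩) dμ(x)` of a measure on `ℝ^d`. -/
def fourierTransform {d : ℕ} (μ : MeasureTheory.Measure (Fin d → ℝ)) (t : Fin d → ℝ) : ℂ :=
  ∫ x, Complex.exp (-(2 * (Real.pi : ℂ) * Complex.I * ((∑ i, t i * x i : ℝ) : ℂ))) ∂μ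

/-- The target set of all `x ∈ [0,1)^d` with `‖x_i‖ ≤ r_i(n)` for every `i`, where `‖·‖` is the
distance to the nearest integer. -/
def targetSet {d : ℕ} (r : Fin d → ℕ → ℝ) (n : ℕ) : Set (Fin d → ℝ) :=
  {x | x ∈ unitCube d ∧ ∀ i, distInt (x i) ≤ r i n}

/-- `y ∈ S (mod 1)`: the vector `y` is congruent modulo `ℤ^d` to an element of `S`. -/
def MemModOne {d : ℕ} (y : Fin d → ℝ) (S : Set (Fin d → ℝ)) : Prop :=
  ∃ z ∈ S, ∃ k : Fin d → ℤ, ∀ i, y i = z i + (k i : ℝ)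

/-- The set of all `β ∈ [0,1)^d` such that `A_n α ∈ β + R_n(r) (mod 1)` for infinitely many `n`,
where `R_n(r)` is the target set. -/
def twistedSet {d : ℕ} (A : ℕ → Matrix (Fin d) (Fin d) ℤ) (r : Fin d → ℕ → ℝ)
    (α : Fin d → ℝ) : Set (Fin d → ℝ) :=
  {β | β ∈ unitCube d ∧ ∃ᶠ n in Filter.atTop,
    MemModOne (Matrix.mulVec (realMat (A n)) α) ((fun x => β + x) '' targetSet r n)}

end TwistedApprox

end

namespace TwistedApprox

open MeasureTheory Filter Set Matrix UnitAddTorus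
open scoped Topology ComplexConjugate

/-! ### Second-moment Borel–Cantelli lemma. -/

section BorelCantelli

variable {Ω : Type*} [MeasurableSpace Ω] {P : Measure Ω}

/-! Treat `α` and `β` together: on the product of `μ` with Haar measure on the torus, let `E n` be
the event that `A_n α - β` lies in the box of radii `r_i(n)`. For each fixed `α` it has probability
`2^d ∏ r_i(n)`, so convergence is the usual Borel–Cantelli lemma.

For divergence, Parseval in `β` followed by integration in `α` writes `P(E m ∩ E n)` as a sum over
`k ∈ ℤ^d` of products of box Fourier coefficients times `μ̂((A_n - A_m)ᵀ k)`. The term `k = 0` is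
`P(E m) P(E n)`. The coefficient products have absolute sum at most `1`, so the rest is bounded by
the largest `|μ̂|` that occurs (`integral_volume_inter_le`). Lacunarity gives `|(A_n - A_m)ᵀ k|_∞ ≥
c K^n` for `m < n` (`exists_mul_pow_le_norm_vecMul`), so logarithmic decay bounds the error by a
multiple of `n^(-s)`, uniformly in `m`. As `s > d + 1 ≥ 2`, the errors summed over pairs `m < n` are
finite, and Chebyshev's inequality gives infinitely many hits for almost every `(α, β)`; Fubini
concludes. -/

/-- The centred indicator function of a set. -/
noncomputable def centredIndicator (P : Measure Ω) (E : Set Ω) (ω : Ω) : ℝ :=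
  E.indicator 1 ω - P.real E

lemma measurable_centredIndicator {E : Set Ω} (hE : MeasurableSet E) :
    Measurable (centredIndicator P E) :=
  (measurable_one.indicator hE).sub_const _

variable [IsProbabilityMeasure P]

lemma abs_centredIndicator_le (E : Set Ω) (ω : Ω) : |centredIndicator P E ω| ≤ 1 := by
  have h0 : 0 ≤ P.real E := measureReal_nonneg
  have h1 : P.real E ≤ 1 := measureReal_le_one
  unfold centredIndicator
  by_cases h : ω ∈ E <;> simp [h, abs_le] <;> linarith

lemma integrable_centredIndicator_mul {E F : Set Ω} (hE : MeasurableSet E)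
    (hF : MeasurableSet F) :
    Integrable (fun ω => centredIndicator P E ω * centredIndicator P F ω) P := by
  refine Integrable.of_bound (C := 1)
    ((measurable_centredIndicator hE).mul (measurable_centredIndicator hF)).aestronglyMeasurable
    (ae_of_all _ fun ω => ?_)
  rw [norm_mul]
  exact mul_le_one₀ (abs_centredIndicator_le E ω) (norm_nonneg _) (abs_centredIndicator_le F ω)

lemma integral_centredIndicator_mul {E F : Set Ω} (hE : MeasurableSet E)
    (hF : MeasurableSet F) :
    ∫ ω, centredIndicator P E ω * centredIndicator P F ω ∂P
      = P.real (E ∩ F) - P.real E * P.real F := by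
  have hi : ∀ {G : Set Ω}, MeasurableSet G → Integrable (G.indicator (1 : Ω → ℝ)) P := fun hG =>
    (integrable_const (1 : ℝ)).indicator hG
  have h : ∀ ω, centredIndicator P E ω * centredIndicator P F ω
      = (E ∩ F).indicator 1 ω - P.real F * E.indicator 1 ω - P.real E * F.indicator 1 ω
        + P.real E * P.real F := by
    intro ω
    unfold centredIndicator
    by_cases h1 : ω ∈ E <;> by_cases h2 : ω ∈ F <;> simp [h1, h2] <;> ring
  have iE : Integrable (fun ω => P.real F * E.indicator (1 : Ω → ℝ) ω) P := (hi hE).const_mul _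
  have iF : Integrable (fun ω => P.real E * F.indicator (1 : Ω → ℝ) ω) P := (hi hF).const_mul _
  have i1 : Integrable (fun ω =>
      (E ∩ F).indicator (1 : Ω → ℝ) ω - P.real F * E.indicator (1 : Ω → ℝ) ω) P :=
    (hi (hE.inter hF)).sub iE
  have i2 : Integrable (fun ω => (E ∩ F).indicator (1 : Ω → ℝ) ω
      - P.real F * E.indicator (1 : Ω → ℝ) ω - P.real E * F.indicator (1 : Ω → ℝ) ω) P := i1.sub iF
  simp_rw [h]
  rw [integral_add i2 (integrable_const _), integral_sub i1 iF, integral_sub (hi (hE.inter hF)) iE,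
    integral_const_mul, integral_const_mul, integral_indicator_one hE, integral_indicator_one hF,
    integral_indicator_one (hE.inter hF)]
  simp
  ring

lemma integrable_sq_sum_centredIndicator {E : ℕ → Set Ω} (hE : ∀ n, MeasurableSet (E n)) (N : ℕ) :
    Integrable (fun ω => (∑ n ∈ Finset.range N, centredIndicator P (E n) ω) ^ 2) P := by
  simp_rw [sq, Finset.sum_mul_sum]
  exact integrable_finsetSum _ fun i _ => integrable_finsetSum _ fun j _ =>
    integrable_centredIndicator_mul (hE i) (hE j)

/-- The variance bound for a sequence of events with small correlations. -/
lemma integral_sq_sum_centredIndicator_le {E : ℕ → Set Ω} (hE : ∀ n, MeasurableSet (E n))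
    {b : ℕ → ℝ}
    (hcor : ∀ m n, m < n → P.real (E m ∩ E n) ≤ P.real (E m) * P.real (E n) + b n) (N : ℕ) :
    ∫ ω, (∑ n ∈ Finset.range N, centredIndicator P (E n) ω) ^ 2 ∂P
      ≤ ∑ n ∈ Finset.range N, P.real (E n) + 2 * ∑ n ∈ Finset.range N, n * b n := by
  induction N with
  | zero => simp
  | succ N ih =>
    have h : ∀ ω, (∑ n ∈ Finset.range (N + 1), centredIndicator P (E n) ω) ^ 2
        = (∑ n ∈ Finset.range N, centredIndicator P (E n) ω) ^ 2
          + 2 * ∑ n ∈ Finset.range N, centredIndicator P (E n) ω * centredIndicator P (E N) ω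
          + centredIndicator P (E N) ω * centredIndicator P (E N) ω := by
      intro ω
      rw [Finset.sum_range_succ, ← Finset.sum_mul]
      ring
    have i2 : ∀ n ∈ Finset.range N,
        Integrable (fun ω => centredIndicator P (E n) ω * centredIndicator P (E N) ω) P :=
      fun n _ => integrable_centredIndicator_mul (hE n) (hE N)
    have i1 := integrable_sq_sum_centredIndicator (P := P) hE N
    have i3 : Integrable (fun ω =>
        2 * ∑ n ∈ Finset.range N, centredIndicator P (E n) ω * centredIndicator P (E N) ω) P :=
      (integrable_finsetSum _ i2).const_mul 2
    have i4 : Integrable (fun ω => (∑ n ∈ Finset.range N, centredIndicator P (E n) ω) ^ 2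
        + 2 * ∑ n ∈ Finset.range N, centredIndicator P (E n) ω * centredIndicator P (E N) ω) P :=
      i1.add i3
    simp_rw [h]
    rw [integral_add i4 (integrable_centredIndicator_mul (hE N) (hE N)),
      integral_add i1 i3, integral_const_mul, integral_finsetSum _ i2,
      integral_centredIndicator_mul (hE N) (hE N), Finset.sum_range_succ, Finset.sum_range_succ,
      inter_self]
    -- The error depends only on the later index, so the `N` pairs ending at `N` cost `N * b N`.
    have hs : ∑ n ∈ Finset.range N, ∫ ω, centredIndicator P (E n) ω * centredIndicator P (E N) ω ∂P
        ≤ N * b N := by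
      calc _ ≤ ∑ n ∈ Finset.range N, b N := by
            refine Finset.sum_le_sum fun n hn => ?_
            rw [integral_centredIndicator_mul (hE n) (hE N)]
            linarith [hcor n N (Finset.mem_range.1 hn)]
        _ = N * b N := by simp
    nlinarith [mul_self_nonneg (P.real (E N))]

/-- A divergence Borel–Cantelli lemma for events with summable correlations. -/
theorem ae_frequently_mem_of_correlation_le {E : ℕ → Set Ω} (hE : ∀ n, MeasurableSet (E n))
    {b : ℕ → ℝ} (hb0 : ∀ n, 0 ≤ b n) (hb : Summable fun n : ℕ => n * b n)
    (hcor : ∀ m n, m < n → P.real (E m ∩ E n) ≤ P.real (E m) * P.real (E n) + b n)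
    (hdiv : ¬ Summable fun n => P.real (E n)) :
    ∀ᵐ ω ∂P, ∃ᶠ n in atTop, ω ∈ E n := by
  set C := 2 * ∑' n : ℕ, n * b n with hC
  have hC0 : 0 ≤ C := mul_nonneg zero_le_two (tsum_nonneg fun n => mul_nonneg n.cast_nonneg (hb0 n))
  set ψ : ℕ → ℝ := fun N => ∑ n ∈ Finset.range N, P.real (E n) with hψ
  have hψ_top : Tendsto ψ atTop atTop :=
    (not_summable_iff_tendsto_nat_atTop_of_nonneg fun n => measureReal_nonneg).1 hdiv
  set S : ℕ → Ω → ℝ := fun N ω => ∑ n ∈ Finset.range N, (E n).indicator (1 : Ω → ℝ) ω with hS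
  have hS_meas : ∀ N, Measurable (S N) := fun N =>
    Finset.measurable_fun_sum _ fun n _ => measurable_one.indicator (hE n)
  have hSψ : ∀ N ω, ∑ n ∈ Finset.range N, centredIndicator P (E n) ω = S N ω - ψ N := by
    intro N ω
    simp only [hS, hψ, centredIndicator, Finset.sum_sub_distrib]
  have hV : ∀ N, ∫ ω, (S N ω - ψ N) ^ 2 ∂P ≤ ψ N + C := by
    intro N
    have h1 := integral_sq_sum_centredIndicator_le (P := P) hE hcor N
    simp_rw [hSψ] at h1
    have h2 : ∑ n ∈ Finset.range N, (n : ℝ) * b n ≤ ∑' n : ℕ, (n : ℝ) * b n :=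
      hb.sum_le_tsum _ fun n _ => mul_nonneg n.cast_nonneg (hb0 n)
    linarith
  have hi : ∀ N, Integrable (fun ω => (S N ω - ψ N) ^ 2) P := by
    intro N
    have := integrable_sq_sum_centredIndicator (P := P) hE N
    simpa only [hSψ] using this
  -- Chebyshev: where all `S N ≤ M`, the deviation from the mean is at least `ψ N - M`, whose square
  -- outgrows the variance bound `ψ N + C`.
  have hD : ∀ M : ℕ, P {ω | ∀ N, S N ω ≤ M} = 0 := by
    intro M
    set D := {ω | ∀ N, S N ω ≤ M} with hDdef
    have hDm : MeasurableSet D := by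
      rw [hDdef, ofPred_forall]
      exact MeasurableSet.iInter fun N => measurableSet_le (hS_meas N) measurable_const
    have key : ∀ N, (M : ℝ) ≤ ψ N → P.real D * (ψ N - M) ^ 2 ≤ ψ N + C := by
      intro N hN
      refine le_trans ?_ (hV N)
      have h1 : ∫ ω, D.indicator (fun _ => (ψ N - M) ^ 2) ω ∂P = P.real D * (ψ N - M) ^ 2 := by
        rw [integral_indicator_const _ hDm, smul_eq_mul]
      rw [← h1]
      refine integral_mono ((integrable_const _).indicator hDm) (hi N) fun ω => ?_
      by_cases h : ω ∈ D
      · simp only [h, indicator_of_mem]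
        have := h N
        nlinarith
      · simp only [h, not_false_eq_true, indicator_of_notMem]
        positivity
    by_contra hne
    have hq : 0 < P.real D := ENNReal.toReal_pos hne (measure_ne_top _ _)
    -- With `x = ψ N - M` this threshold forces `x ≥ 1` and `P(D) x > 1 + M + C`, hence `P(D) x² > x
    -- + M + C`, against `key`.
    obtain ⟨N, hN⟩ := (hψ_top.eventually_ge_atTop
      (M + (1 + (1 + M + C) / P.real D))).exists
    have hMC : 0 ≤ (1 + M + C) / P.real D := by positivity
    have h1 := key N (by linarith)
    set x := ψ N - M with hx
    have hx1 : 1 + (1 + M + C) / P.real D ≤ x := by linarith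
    have h2 : (1 + M + C) < P.real D * x := by
      have : (1 + M + C) / P.real D < x := by linarith
      rwa [div_lt_iff₀' hq] at this
    have h3 : 1 ≤ x := by linarith
    have h4 : (0 : ℝ) ≤ M := M.cast_nonneg
    nlinarith
  have hall : ∀ᵐ ω ∂P, ∀ M : ℕ, ω ∉ {ω | ∀ N, S N ω ≤ M} :=
    ae_all_iff.2 fun M => measure_eq_zero_iff_ae_notMem.1 (hD M)
  filter_upwards [hall] with ω hω
  by_contra hnf
  obtain ⟨n₀, hn₀⟩ := eventually_atTop.1 (not_frequently.1 hnf)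
  refine hω n₀ fun N => ?_
  calc S N ω ≤ ∑ n ∈ Finset.range N, if n < n₀ then (1 : ℝ) else 0 := by
        refine Finset.sum_le_sum fun n _ => ?_
        split_ifs with h
        · exact indicator_le_self' (fun _ _ => zero_le_one) ω
        · simp [hn₀ n (not_lt.1 h)]
    _ = ((Finset.range N).filter (· < n₀)).card := by simp
    _ ≤ (Finset.range n₀).card := by
        refine Nat.cast_le.2 (Finset.card_le_card fun n hn => ?_)
        simp_all
    _ = n₀ := by simp

end BorelCantelli

/-! ### Expansion of integral frequencies under transposed differences. -/

section Expansion

variable {d : ℕ}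

lemma smallestSingularValue_mul_norm_le (M : Matrix (Fin d) (Fin d) ℝ)
    (x : EuclideanSpace ℝ (Fin d)) :
    smallestSingularValue M * ‖x‖ ≤ ‖toEuclideanLin M x‖ := by
  rcases eq_or_ne x 0 with rfl | hx
  · simp
  have hx' : 0 < ‖x‖ := norm_pos_iff.2 hx
  have h1 : smallestSingularValue M ≤ ‖toEuclideanLin M (‖x‖⁻¹ • x)‖ := by
    refine csInf_le ⟨0, ?_⟩ ⟨_, ?_, rfl⟩
    · rintro _ ⟨y, -, rfl⟩
      exact norm_nonneg _
    · simp [norm_smul, hx'.ne']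
  rw [map_smul, norm_smul, norm_inv, norm_norm, inv_mul_eq_div, le_div_iff₀ hx'] at h1
  exact h1

/-- A lower bound for the smallest singular value bounds the transposed matrix from below. -/
lemma mul_norm_le_norm_transpose {M : Matrix (Fin d) (Fin d) ℝ} {c : ℝ} (hc : 0 < c)
    (hM : c ≤ smallestSingularValue M) (y : EuclideanSpace ℝ (Fin d)) :
    c * ‖y‖ ≤ ‖toEuclideanLin Mᵀ y‖ := by
  have hexp : ∀ x, c * ‖x‖ ≤ ‖toEuclideanLin M x‖ := fun x =>
    (mul_le_mul_of_nonneg_right hM (norm_nonneg x)).trans (smallestSingularValue_mul_norm_le M x)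
  have hinj : Function.Injective (toEuclideanLin M) := by
    refine (injective_iff_map_eq_zero _).2 fun x hx => ?_
    have := hexp x
    rw [hx, norm_zero] at this
    exact norm_le_zero_iff.1 (by nlinarith [norm_nonneg x])
  -- With `y = M x`: `‖Mx‖² = ⟨MᵀMx, x⟩ ≤ ‖MᵀMx‖ ‖x‖ ≤ ‖MᵀMx‖ ‖Mx‖ / c`.
  obtain ⟨x, rfl⟩ := LinearMap.surjective_of_injective hinj y
  have hinner : inner ℝ (toEuclideanLin M x) (toEuclideanLin M x)
      = inner ℝ (toEuclideanLin Mᵀ (toEuclideanLin M x)) x := by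
    have h := toEuclideanLin_conjTranspose_eq_adjoint Mᵀ
    rw [conjTranspose_eq_transpose_of_trivial, transpose_transpose] at h
    conv_lhs => rw [h]
    rw [← h, h, LinearMap.adjoint_inner_right]
  rw [real_inner_self_eq_norm_sq] at hinner
  have hcs := real_inner_le_norm (toEuclideanLin Mᵀ (toEuclideanLin M x)) x
  rw [← hinner] at hcs
  have hx := hexp x
  set a := ‖toEuclideanLin M x‖
  set t := ‖toEuclideanLin Mᵀ (toEuclideanLin M x)‖
  have ha : 0 ≤ a := norm_nonneg _
  have ht : 0 ≤ t := norm_nonneg _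
  rcases ha.eq_or_lt with h0 | h0
  · rw [← h0]; simpa using ht
  refine le_of_mul_le_mul_right ?_ h0
  nlinarith

/-- The inverse of a singular matrix is `0` by convention, and the zero matrix in positive dimension
has no positive singular value. -/
lemma isUnit_det_of_lt_smallestSingularValue (hd : 1 ≤ d) {M : Matrix (Fin d) (Fin d) ℝ}
    (N : Matrix (Fin d) (Fin d) ℝ) (h : 0 < smallestSingularValue (N * M⁻¹)) :
    IsUnit M.det := by
  by_contra hM
  have : Nonempty (Fin d) := ⟨⟨0, hd⟩⟩
  rw [nonsing_inv_apply_not_isUnit _ hM, mul_zero] at h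
  obtain ⟨x, hx⟩ := exists_ne (0 : EuclideanSpace ℝ (Fin d))
  have h1 := smallestSingularValue_mul_norm_le (0 : Matrix (Fin d) (Fin d) ℝ) x
  simp only [map_zero, LinearMap.zero_apply, norm_zero] at h1
  exact absurd h1 (not_le.2 (mul_pos h (norm_pos_iff.2 hx)))

variable {A : ℕ → Matrix (Fin d) (Fin d) ℝ} {K : ℝ}

/-- The quotient telescopes into `j` consecutive ones, each of whose transposes expands by `K`. -/
lemma pow_mul_norm_le_norm_transpose (hd : 1 ≤ d) (hK : 0 < K)
    (hA : ∀ n, K ≤ smallestSingularValue (A (n + 1) * (A n)⁻¹)) (m j : ℕ)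
    (y : EuclideanSpace ℝ (Fin d)) :
    K ^ j * ‖y‖ ≤ ‖toEuclideanLin (A (m + j) * (A m)⁻¹)ᵀ y‖ := by
  have hdet : ∀ n, IsUnit (A n).det := fun n =>
    isUnit_det_of_lt_smallestSingularValue hd _ (hK.trans_le (hA n))
  induction j generalizing y with
  | zero => simp [mul_nonsing_inv _ (hdet m), toLpLin_one]
  | succ j ih =>
    have h : (A (m + (j + 1)) * (A m)⁻¹)ᵀ
        = (A (m + j) * (A m)⁻¹)ᵀ * (A (m + j + 1) * (A (m + j))⁻¹)ᵀ := by
      rw [← transpose_mul, ← add_assoc, Matrix.mul_assoc, ← Matrix.mul_assoc _ (A (m + j)),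
        nonsing_inv_mul _ (hdet _), Matrix.one_mul]
    rw [h, toLpLin_mul 2 2 2, LinearMap.comp_apply]
    refine le_trans ?_ (ih _)
    rw [pow_succ, mul_assoc]
    exact mul_le_mul_of_nonneg_left (mul_norm_le_norm_transpose hK (hA (m + j)) y) (by positivity)

/-- Expansion of differences along a lacunary sequence of matrices. -/
lemma pow_sub_pow_mul_norm_le (hd : 1 ≤ d) (hK : 1 < K) (hA0 : A 0 = 1)
    (hA : ∀ n, K ≤ smallestSingularValue (A (n + 1) * (A n)⁻¹)) {m n : ℕ} (hmn : m ≤ n)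
    (y : EuclideanSpace ℝ (Fin d)) :
    (K ^ n - K ^ m) * ‖y‖ ≤ ‖toEuclideanLin (A n - A m)ᵀ y‖ := by
  obtain ⟨j, rfl⟩ := Nat.exists_eq_add_of_le hmn
  have hK0 : 0 < K := zero_lt_one.trans hK
  have hdet : IsUnit (A m).det :=
    isUnit_det_of_lt_smallestSingularValue hd _ (hK0.trans_le (hA m))
  -- With `Q = A (m + j) * (A m)⁻¹`, the transposed difference is `(A m)ᵀ (Qᵀ - 1)`; the factors
  -- expand by `K^m` (as `A 0 = 1`) and `K^j - 1`.
  have h1 := pow_mul_norm_le_norm_transpose hd hK0 hA m j y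
  have h2 := pow_mul_norm_le_norm_transpose hd hK0 hA 0 m
    (toEuclideanLin (A (m + j) * (A m)⁻¹)ᵀ y - y)
  rw [hA0, inv_one, mul_one, zero_add] at h2
  have h3 : toEuclideanLin (A m)ᵀ (toEuclideanLin (A (m + j) * (A m)⁻¹)ᵀ y - y)
      = toEuclideanLin (A (m + j) - A m)ᵀ y := by
    rw [map_sub, transpose_sub, map_sub, LinearMap.sub_apply, ← LinearMap.comp_apply,
      ← toLpLin_mul 2 2 2, ← transpose_mul, Matrix.mul_assoc, nonsing_inv_mul _ hdet,
      Matrix.mul_one]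
  rw [h3] at h2
  refine le_trans ?_ h2
  have h4 := norm_sub_norm_le (toEuclideanLin (A (m + j) * (A m)⁻¹)ᵀ y) y
  have h5 : 0 < K ^ m := by positivity
  rw [pow_add]
  nlinarith

/-- The maximum norm of the image of a nonzero integral vector. -/
lemma exists_mul_pow_le_norm_vecMul (hd : 1 ≤ d) (hK : 1 < K) (hA0 : A 0 = 1)
    (hA : ∀ n, K ≤ smallestSingularValue (A (n + 1) * (A n)⁻¹)) :
    ∃ c > 0, ∀ m n, m < n → ∀ k : Fin d → ℤ, k ≠ 0 →
      c * K ^ n ≤ ‖(A n - A m)ᵀ *ᵥ (fun i => (k i : ℝ))‖ := by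
  have hK0 : 0 < K := zero_lt_one.trans hK
  have hd0 : (0 : ℝ) < √d := Real.sqrt_pos.2 (by exact_mod_cast hd)
  -- `1 - K⁻¹` comes from `K^m ≤ K^(n-1)`, and `√d` from comparing the Euclidean and maximum norms.
  refine ⟨(1 - K⁻¹) / √d, div_pos (sub_pos.2 (inv_lt_one_of_one_lt₀ hK)) hd0,
    fun m n hmn k hk => ?_⟩
  set y : EuclideanSpace ℝ (Fin d) := WithLp.toLp 2 (fun i => (k i : ℝ)) with hy
  have hy1 : 1 ≤ ‖y‖ := by
    obtain ⟨i, hi⟩ := Function.ne_iff.1 hk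
    refine le_trans ?_ (PiLp.norm_apply_le y i)
    have : (1 : ℤ) ≤ |k i| := Int.one_le_abs hi
    change (1 : ℝ) ≤ |(k i : ℝ)|
    exact_mod_cast this
  have h1 := pow_sub_pow_mul_norm_le hd hK hA0 hA hmn.le y
  have h2 : ‖toEuclideanLin (A n - A m)ᵀ y‖
      ≤ √d * ‖(A n - A m)ᵀ *ᵥ (fun i => (k i : ℝ))‖ := by
    have := PiLp.lipschitzWith_toLp 2 (fun _ : Fin d => ℝ)
    have h := this.norm_le_mul (by simp) ((A n - A m)ᵀ *ᵥ (fun i => (k i : ℝ)))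
    rw [toLpLin_apply, hy, Real.sqrt_eq_rpow]
    simpa [-transpose_sub] using h
  have h3 : K ^ m ≤ K ^ n * K⁻¹ := by
    obtain ⟨j, rfl⟩ : ∃ j, n = j + 1 := ⟨n - 1, by omega⟩
    rw [pow_succ, mul_assoc, mul_inv_cancel₀ hK0.ne', mul_one]
    exact pow_le_pow_right₀ hK.le (by omega)
  have h4 : 0 ≤ K ^ n - K ^ m := sub_nonneg.2 (pow_le_pow_right₀ hK.le hmn.le)
  rw [div_mul_eq_mul_div, div_le_iff₀ hd0]
  nlinarith

end Expansion

/-! ### Fourier decay along exponentially growing frequencies. -/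

section Decay

variable {d : ℕ} {μ : Measure (Fin d → ℝ)}

lemma norm_exp_neg_two_pi_I_mul (x : ℝ) :
    ‖Complex.exp (-(2 * (Real.pi : ℂ) * Complex.I * (x : ℂ)))‖ = 1 := by
  rw [show -(2 * (Real.pi : ℂ) * Complex.I * (x : ℂ))
    = ((-(2 * Real.pi * x) : ℝ) : ℂ) * Complex.I by push_cast; ring]
  exact Complex.norm_exp_ofReal_mul_I _

lemma norm_fourierTransform_le_one [IsProbabilityMeasure μ] (t : Fin d → ℝ) :
    ‖fourierTransform μ t‖ ≤ 1 := by
  refine (norm_integral_le_of_norm_le_const (C := 1) (ae_of_all _ fun x => ?_)).trans (by simp)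
  exact (norm_exp_neg_two_pi_I_mul _).le

/-- Logarithmic Fourier decay gives polynomial decay along exponentially growing frequencies. -/
lemma exists_norm_fourierTransform_le [IsProbabilityMeasure μ] {s : ℝ} (hs : 0 < s)
    (hdecay : Asymptotics.IsBigO (comap (fun t : Fin d → ℝ => ‖t‖) atTop)
      (fourierTransform μ) (fun t : Fin d → ℝ => (Real.log ‖t‖) ^ (-s)))
    {c K : ℝ} (hc : 0 < c) (hK : 1 < K) :
    ∃ C ≥ 0, ∀ (n : ℕ) (t : Fin d → ℝ), c * K ^ n ≤ ‖t‖ →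
      ‖fourierTransform μ t‖ ≤ C * ((n : ℝ) + 1) ^ (-s) := by
  obtain ⟨C, hC0, hC⟩ := hdecay.exists_pos
  obtain ⟨T, hT⟩ := eventually_atTop.1 (eventually_comap.1 hC.bound)
  have hK0 : 0 < K := zero_lt_one.trans hK
  have hlK : 0 < Real.log K := Real.log_pos hK
  -- Half of the growth rate of `log (c * K ^ n)` is given up to absorb `log c` and the shift to `n
  -- + 1`.
  set δ := Real.log K / 2 with hδ
  have hδ0 : 0 < δ := half_pos hlK
  have hlarge : ∀ᶠ n : ℕ in atTop, T ≤ c * K ^ n ∧ ((n : ℝ) + 1) * δ ≤ Real.log (c * K ^ n) := by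
    refine (((tendsto_pow_atTop_atTop_of_one_lt hK).const_mul_atTop hc).eventually_ge_atTop T).and ?_
    filter_upwards [(tendsto_natCast_atTop_atTop.const_mul_atTop hδ0).eventually_ge_atTop
      (δ - Real.log c)] with n hn
    rw [Real.log_mul hc.ne' (pow_pos hK0 n).ne', Real.log_pow]
    have : Real.log K = 2 * δ := by rw [hδ]; ring
    rw [this]
    linarith
  obtain ⟨n₀, hn₀⟩ := eventually_atTop.1 hlarge
  -- The second constant handles `n ≤ n₀` through the trivial bound `|μ̂| ≤ 1`.
  refine ⟨max (C * δ ^ (-s)) (((n₀ : ℝ) + 1) ^ s), le_max_of_le_right (by positivity),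
    fun n t ht => ?_⟩
  have hn1 : (0 : ℝ) < n + 1 := by positivity
  rcases le_total n₀ n with h | h
  · obtain ⟨h1, h2⟩ := hn₀ n h
    have h3 : ((n : ℝ) + 1) * δ ≤ Real.log ‖t‖ :=
      h2.trans (Real.log_le_log (by positivity) ht)
    have h4 := hT ‖t‖ (h1.trans ht) t rfl
    have h5 : 0 < Real.log ‖t‖ := (by positivity : 0 < ((n : ℝ) + 1) * δ).trans_le h3
    rw [Real.norm_of_nonneg (by positivity)] at h4
    calc _ ≤ C * Real.log ‖t‖ ^ (-s) := h4
      _ ≤ C * (((n : ℝ) + 1) * δ) ^ (-s) :=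
          mul_le_mul_of_nonneg_left
            (Real.rpow_le_rpow_of_nonpos (by positivity) h3 (by linarith)) hC0.le
      _ = C * δ ^ (-s) * ((n : ℝ) + 1) ^ (-s) := by
          rw [Real.mul_rpow hn1.le hδ0.le]; ring
      _ ≤ _ := mul_le_mul_of_nonneg_right (le_max_left _ _) (by positivity)
  · calc _ ≤ 1 := norm_fourierTransform_le_one t
      _ = ((n : ℝ) + 1) ^ s * ((n : ℝ) + 1) ^ (-s) := by
          rw [← Real.rpow_add hn1, add_neg_cancel, Real.rpow_zero]
      _ ≤ ((n₀ : ℝ) + 1) ^ s * ((n : ℝ) + 1) ^ (-s) := by gcongr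
      _ ≤ _ := mul_le_mul_of_nonneg_right (le_max_right _ _) (by positivity)

end Decay

-- Haar measure and Fourier series on the torus.

attribute [local instance] instMeasureSpaceUnitAddCircle

lemma isAddHaarMeasure_unitAddCircle : Measure.IsAddHaarMeasure (volume : Measure UnitAddCircle) :=
  inferInstanceAs (Measure.IsAddHaarMeasure AddCircle.haarAddCircle)

lemma isProbabilityMeasure_unitAddCircle : IsProbabilityMeasure (volume : Measure UnitAddCircle) :=
  inferInstanceAs (IsProbabilityMeasure AddCircle.haarAddCircle)

lemma isNegInvariant_unitAddCircle :
    Measure.IsNegInvariant (volume : Measure UnitAddCircle) :=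
  inferInstanceAs (Measure.IsNegInvariant (Measure.addHaarMeasure ⊤))

attribute [local instance] isNegInvariant_unitAddCircle isAddHaarMeasure_unitAddCircle
  isProbabilityMeasure_unitAddCircle

section Torus

variable {d : ℕ}

/-- The projection `ℝ^d → ℝ^d / ℤ^d`. -/
def toTorus (x : Fin d → ℝ) : UnitAddTorus (Fin d) := fun i => (x i : UnitAddCircle)

lemma toTorus_sub (x y : Fin d → ℝ) : toTorus (x - y) = toTorus x - toTorus y := rfl

lemma continuous_toTorus : Continuous (toTorus (d := d)) :=
  continuous_pi fun i => (AddCircle.continuous_mk' 1).comp (continuous_apply i)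

/-- The box of radii `ρ` around zero in the torus. -/
def torusBox (ρ : Fin d → ℝ) : Set (UnitAddTorus (Fin d)) := {x | ∀ i, ‖x i‖ ≤ ρ i}

lemma isClosed_torusBox (ρ : Fin d → ℝ) : IsClosed (torusBox ρ) := by
  rw [torusBox, ofPred_forall]
  exact isClosed_iInter fun i => isClosed_le (continuous_apply i).norm continuous_const

lemma haarAddCircle_eq_volume :
    (AddCircle.haarAddCircle : Measure UnitAddCircle) = (AddCircle.measureSpace 1).volume := by
  rw [AddCircle.volume_eq_smul_haarAddCircle]; simp

/-- Radii below `1/2` keep the arcs from wrapping around the circle. -/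
lemma volume_torusBox {ρ : Fin d → ℝ} (hρ : ∀ i, ρ i ∈ Ioo (0 : ℝ) (1 / 2)) :
    volume (torusBox ρ) = ENNReal.ofReal (∏ i, 2 * ρ i) := by
  have h : torusBox ρ = univ.pi fun i => Metric.closedBall (0 : UnitAddCircle) (ρ i) := by
    ext x; simp [torusBox]
  rw [h, volume_pi_pi, ENNReal.ofReal_prod_of_nonneg fun i _ => by linarith [(hρ i).1]]
  refine Finset.prod_congr rfl fun i _ => ?_
  change AddCircle.haarAddCircle _ = _
  rw [haarAddCircle_eq_volume, AddCircle.volume_closedBall, min_eq_right]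
  linarith [(hρ i).2]

lemma mFourier_toTorus (k : Fin d → ℤ) (x : Fin d → ℝ) :
    mFourier k (toTorus x)
      = Complex.exp (2 * (Real.pi : ℂ) * Complex.I * ((∑ i, (k i : ℝ) * x i : ℝ) : ℂ)) := by
  simp only [mFourier, ContinuousMap.coe_mk, toTorus, fourier_coe_apply]
  rw [← Complex.exp_sum]
  congr 1
  push_cast
  rw [Finset.mul_sum]
  refine Finset.sum_congr rfl fun i _ => ?_
  simp; ring

lemma norm_mFourier_apply (k : Fin d → ℤ) (x : UnitAddTorus (Fin d)) : ‖mFourier k x‖ = 1 := by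
  simp only [mFourier, ContinuousMap.coe_mk, norm_prod, fourier_apply, Circle.norm_coe,
    Finset.prod_const_one]

lemma mFourier_sub (k : Fin d → ℤ) (x y : UnitAddTorus (Fin d)) :
    mFourier k (x - y) = mFourier k x * mFourier (-k) y := by
  simp only [mFourier, ContinuousMap.coe_mk, ← Finset.prod_mul_distrib]
  refine Finset.prod_congr rfl fun i _ => ?_
  simp [fourier_apply, sub_eq_add_neg, AddCircle.toCircle_add]

/-- The complex-valued indicator function of a set. -/
noncomputable def cindicator {X : Type*} (B : Set X) : X → ℂ := B.indicator 1

lemma memLp_cindicator {B : Set (UnitAddTorus (Fin d))} (hB : MeasurableSet B) :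
    MemLp (cindicator B) 2 volume :=
  memLp_indicator_const 2 hB (1 : ℂ) (Or.inr (measure_ne_top _ _))

lemma mFourierCoeff_congr_ae {f g : UnitAddTorus (Fin d) → ℂ} (h : f =ᵐ[volume] g)
    (k : Fin d → ℤ) : mFourierCoeff f k = mFourierCoeff g k :=
  integral_congr_ae (h.mono fun x hx => by simp only [hx])

/-- Parseval's identity for the indicator functions of two sets. -/
lemma hasSum_mFourierCoeff_cindicator {B B' : Set (UnitAddTorus (Fin d))} (hB : MeasurableSet B)
    (hB' : MeasurableSet B') :
    HasSum (fun k => conj (mFourierCoeff (cindicator B) k) * mFourierCoeff (cindicator B') k)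
      ((volume.real (B ∩ B') : ℝ) : ℂ) := by
  have h := hasSum_prod_mFourierCoeff (memLp_cindicator hB).toLp (memLp_cindicator hB').toLp
  simp_rw [mFourierCoeff_congr_ae (memLp_cindicator hB).coeFn_toLp,
    mFourierCoeff_congr_ae (memLp_cindicator hB').coeFn_toLp] at h
  convert h using 1
  rw [← integral_indicator_one (hB.inter hB'), ← integral_complex_ofReal]
  refine integral_congr_ae ?_
  filter_upwards [(memLp_cindicator hB).coeFn_toLp, (memLp_cindicator hB').coeFn_toLp]
    with x h1 h2
  rw [h1, h2]
  by_cases hx : x ∈ B <;> by_cases hx' : x ∈ B' <;> simp [cindicator, hx, hx']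

lemma hasSum_sq_mFourierCoeff_cindicator {B : Set (UnitAddTorus (Fin d))}
    (hB : MeasurableSet B) :
    HasSum (fun k => ‖mFourierCoeff (cindicator B) k‖ ^ 2) (volume.real B) := by
  have h := hasSum_mFourierCoeff_cindicator hB hB
  rw [inter_self] at h
  refine Complex.hasSum_ofReal.1 ?_
  convert h using 2 with k
  rw [Complex.conj_mul']
  push_cast
  rfl

/-- The Fourier coefficients of the indicator function of a reflected translate. -/
lemma mFourierCoeff_cindicator_preimage_sub (B : Set (UnitAddTorus (Fin d)))
    (a : UnitAddTorus (Fin d)) (k : Fin d → ℤ) :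
    mFourierCoeff (cindicator ((fun y => a - y) ⁻¹' B)) k
      = mFourier (-k) a * mFourierCoeff (cindicator B) (-k) := by
  have h := integral_sub_left_eq_self
    (fun y => mFourier (-k) (a - y) • cindicator B y) volume a
  simp only [sub_sub_cancel] at h
  change ∫ y, mFourier (-k) y • cindicator B (a - y) = _
  rw [h, mFourierCoeff, ← integral_const_mul]
  refine integral_congr_ae (ae_of_all _ fun y => ?_)
  simp only [mFourier_sub, smul_eq_mul, mul_assoc]

variable {μ : Measure (Fin d → ℝ)}

/-- Since `⟨k, M x⟩ = ⟨Mᵀ k, x⟩`, the matrix passes from the point to the frequency. -/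
lemma integral_mFourier_toTorus (k : Fin d → ℤ) (M : Matrix (Fin d) (Fin d) ℝ) :
    ∫ x, mFourier (-k) (toTorus (M *ᵥ x)) ∂μ
      = fourierTransform μ (Mᵀ *ᵥ (fun i => (k i : ℝ))) := by
  refine integral_congr_ae (ae_of_all _ fun x => ?_)
  simp only [mFourier_toTorus]
  have h : ∑ i, (Mᵀ *ᵥ (fun i => (k i : ℝ))) i * x i = ∑ i, (k i : ℝ) * (M *ᵥ x) i := by
    change (Mᵀ *ᵥ (fun i => (k i : ℝ))) ⬝ᵥ x = (fun i => (k i : ℝ)) ⬝ᵥ (M *ᵥ x)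
    rw [mulVec_transpose, dotProduct_mulVec]
  rw [h]
  congr 1
  push_cast [Pi.neg_apply]
  rw [← mul_neg, ← Finset.sum_neg_distrib]
  simp only [neg_mul]

/-- The correlation of two randomly translated sets deviates from independence by at most the
size of the relevant Fourier transforms. -/
lemma integral_volume_inter_le [IsProbabilityMeasure μ] {B B' : Set (UnitAddTorus (Fin d))}
    (hB : MeasurableSet B) (hB' : MeasurableSet B') (M M' : Matrix (Fin d) (Fin d) ℝ) {ε : ℝ}
    (hε : ∀ k : Fin d → ℤ, k ≠ 0 →
      ‖fourierTransform μ ((M' - M)ᵀ *ᵥ (fun i => (k i : ℝ)))‖ ≤ ε) (hε0 : 0 ≤ ε) :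
    ∫ x, volume.real ((fun y => toTorus (M *ᵥ x) - y) ⁻¹' B ∩
        (fun y => toTorus (M' *ᵥ x) - y) ⁻¹' B') ∂μ
      ≤ volume.real B * volume.real B' + ε := by
  set u : (Fin d → ℤ) → ℂ := fun k =>
    conj (mFourierCoeff (cindicator B) (-k)) * mFourierCoeff (cindicator B') (-k) with hu
  have hpre : ∀ (B : Set (UnitAddTorus (Fin d))), MeasurableSet B → ∀ a,
      MeasurableSet ((fun y => a - y) ⁻¹' B) := fun B hB a =>
    (by fun_prop : Measurable fun y => a - y) hB
  have hsum : ∀ x, HasSum (fun k => u k * mFourier (-k) (toTorus ((M' - M) *ᵥ x)))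
      ((volume.real ((fun y => toTorus (M *ᵥ x) - y) ⁻¹' B ∩
        (fun y => toTorus (M' *ᵥ x) - y) ⁻¹' B') : ℝ) : ℂ) := by
    intro x
    convert hasSum_mFourierCoeff_cindicator (hpre B hB (toTorus (M *ᵥ x)))
      (hpre B' hB' (toTorus (M' *ᵥ x))) using 2 with k
    rw [mFourierCoeff_cindicator_preimage_sub, mFourierCoeff_cindicator_preimage_sub, sub_mulVec,
      toTorus_sub, mFourier_sub, map_mul, ← mFourier_neg, hu]
    ring
  have hsq : ∀ B : Set (UnitAddTorus (Fin d)), MeasurableSet B →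
      HasSum (fun k => ‖mFourierCoeff (cindicator B) (-k)‖ ^ 2) (volume.real B) := fun B hB =>
    (Equiv.neg _).hasSum_iff.2 (hasSum_sq_mFourierCoeff_cindicator hB)
  -- By AM–GM and Parseval, `∑ ‖u k‖ ≤ (vol B + vol B') / 2 ≤ 1`, so no decay of the box
  -- coefficients is needed.
  have hmaj := ((hsq B hB).add (hsq B' hB')).mul_left (1 / 2)
  have hu_le : ∀ k, ‖u k‖ ≤ 1 / 2 * (‖mFourierCoeff (cindicator B) (-k)‖ ^ 2
      + ‖mFourierCoeff (cindicator B') (-k)‖ ^ 2) := by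
    intro k
    rw [hu]
    simp only [norm_mul, RCLike.norm_conj]
    nlinarith [sq_nonneg (‖mFourierCoeff (cindicator B) (-k)‖
      - ‖mFourierCoeff (cindicator B') (-k)‖)]
  have hu_sum : Summable fun k => ‖u k‖ :=
    Summable.of_nonneg_of_le (fun _ => norm_nonneg _) hu_le hmaj.summable
  have hu_tsum : ∑' k, ‖u k‖ ≤ 1 := by
    refine (hu_sum.tsum_le_tsum hu_le hmaj.summable).trans ?_
    rw [hmaj.tsum_eq]
    have h1 : volume.real B ≤ 1 := measureReal_le_one
    have h2 : volume.real B' ≤ 1 := measureReal_le_one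
    linarith
  have hint := hasSum_integral_of_dominated_convergence (μ := μ) (fun k _ => ‖u k‖)
    (F := fun k x => u k * mFourier (-k) (toTorus ((M' - M) *ᵥ x)))
    (fun k => Continuous.aestronglyMeasurable (continuous_const.mul ((map_continuous _).comp
      (continuous_toTorus.comp (continuous_const.matrix_mulVec continuous_id)))))
    (fun k => ae_of_all _ fun x => by rw [norm_mul, norm_mFourier_apply, mul_one])
    (ae_of_all _ fun _ => hu_sum) (integrable_const _) (ae_of_all _ hsum)
  simp_rw [integral_const_mul, integral_mFourier_toTorus] at hint
  rw [integral_complex_ofReal] at hint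
  have hcoeff0 : ∀ B : Set (UnitAddTorus (Fin d)), MeasurableSet B →
      mFourierCoeff (cindicator B) 0 = ((volume.real B : ℝ) : ℂ) := by
    intro B hB
    rw [← integral_indicator_one hB, ← integral_complex_ofReal, mFourierCoeff]
    refine integral_congr_ae (ae_of_all _ fun y => ?_)
    by_cases hy : y ∈ B <;> simp [cindicator, hy, mFourier_zero]
  set w : (Fin d → ℤ) → ℂ := fun k =>
    u k * fourierTransform μ ((M' - M)ᵀ *ᵥ (fun i => (k i : ℝ))) with hw
  -- The zero frequency carries the independent main term.
  have hw0 : w 0 = ((volume.real B * volume.real B' : ℝ) : ℂ) := by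
    have h0 : fourierTransform μ ((M' - M)ᵀ *ᵥ (fun i => (((0 : Fin d → ℤ) i : ℤ) : ℝ))) = 1 := by
      have : (fun i => (((0 : Fin d → ℤ) i : ℤ) : ℝ)) = 0 := by ext; simp
      rw [this, mulVec_zero]
      simp [fourierTransform]
    rw [hw]
    simp only [h0, hu, neg_zero, hcoeff0 B hB, hcoeff0 B' hB', Complex.conj_ofReal, mul_one]
    push_cast
    rfl
  have hw_le : ∀ k, ‖w k‖ ≤ (if k = 0 then volume.real B * volume.real B' else 0) + ‖u k‖ * ε := by
    intro k
    split_ifs with h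
    · rw [h, hw0, Complex.norm_real, Real.norm_of_nonneg (by positivity)]
      linarith [mul_nonneg (norm_nonneg (u 0)) hε0]
    · rw [zero_add, hw]
      simp only [norm_mul]
      exact mul_le_mul_of_nonneg_left (hε k h) (norm_nonneg _)
  have hb := (hasSum_ite_eq (0 : Fin d → ℤ) (volume.real B * volume.real B')).add
    (hu_sum.hasSum.mul_right ε)
  have hfin := tsum_of_norm_bounded hb hw_le
  rw [hint.tsum_eq, Complex.norm_real] at hfin
  refine (le_abs_self _).trans (hfin.trans ?_)
  nlinarith

end Torus

/-! ### Hit events on the product space and the two cases. -/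

section Twisted

variable {d : ℕ}

lemma measurePreserving_toTorus :
    MeasurePreserving (toTorus (d := d)) (volume.restrict (unitCube d)) volume := by
  have h1 : MeasurePreserving ((↑) : ℝ → UnitAddCircle) (volume.restrict (Ico (0 : ℝ) 1))
      AddCircle.haarAddCircle := by
    rw [Measure.restrict_congr_set Ico_ae_eq_Ioc, haarAddCircle_eq_volume]
    simpa using UnitAddCircle.measurePreserving_mk 0
  have h2 := measurePreserving_pi (fun _ : Fin d => (volume : Measure ℝ).restrict (Ico (0 : ℝ) 1))
    (fun _ : Fin d => (AddCircle.haarAddCircle : Measure UnitAddCircle)) (fun _ => h1)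
  rwa [← Measure.restrict_pi_pi] at h2

lemma memModOne_image_add_targetSet_iff (r : Fin d → ℕ → ℝ) (n : ℕ) (y β : Fin d → ℝ) :
    MemModOne y ((fun x => β + x) '' targetSet r n)
      ↔ toTorus y - toTorus β ∈ torusBox (fun i => r i n) := by
  have hnorm : ∀ x : ℝ, ‖(x : UnitAddCircle)‖ = distInt x := fun x => UnitAddCircle.norm_eq
  rw [← toTorus_sub]
  constructor
  · rintro ⟨_, ⟨x, ⟨-, hx⟩, rfl⟩, k, hk⟩ i
    have h : ((y i - β i : ℝ) : UnitAddCircle) = ((x i : ℝ) : UnitAddCircle) := by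
      rw [← sub_eq_zero, ← AddCircle.coe_sub, AddCircle.coe_eq_zero_iff]
      exact ⟨k i, by rw [hk i, zsmul_one]; simp only [Pi.add_apply]; ring⟩
    change ‖((y i - β i : ℝ) : UnitAddCircle)‖ ≤ r i n
    rw [h, hnorm]
    exact hx i
  · intro h
    -- Fractional parts are used because the target set lies in `[0,1)^d`.
    refine ⟨_, ⟨fun i => Int.fract (y i - β i), ⟨fun i _ => ⟨Int.fract_nonneg _,
      Int.fract_lt_one _⟩, fun i => ?_⟩, rfl⟩, fun i => ⌊y i - β i⌋, fun i => ?_⟩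
    · rw [← hnorm, AddCircle.coe_fract]
      exact h i
    · simp only [Pi.add_apply]
      linarith [Int.fract_add_floor (y i - β i)]

/-- The pairs `(α, β)` such that `M α - β` lies in the box of radii `ρ` modulo one. -/
def hitSet (M : Matrix (Fin d) (Fin d) ℝ) (ρ : Fin d → ℝ) :
    Set ((Fin d → ℝ) × UnitAddTorus (Fin d)) :=
  {p | toTorus (M *ᵥ p.1) - p.2 ∈ torusBox ρ}

lemma measurableSet_hitSet (M : Matrix (Fin d) (Fin d) ℝ) (ρ : Fin d → ℝ) :
    MeasurableSet (hitSet M ρ) := by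
  have h : Continuous fun p : (Fin d → ℝ) × UnitAddTorus (Fin d) =>
      toTorus (M *ᵥ p.1) - p.2 :=
    (continuous_toTorus.comp (continuous_const.matrix_mulVec continuous_fst)).sub continuous_snd
  exact ((isClosed_torusBox ρ).preimage h).measurableSet

/-- Haar measure is invariant under `β ↦ a - β`, so the value is independent of `α`. -/
lemma volume_preimage_hitSet (M : Matrix (Fin d) (Fin d) ℝ) (ρ : Fin d → ℝ) (α : Fin d → ℝ) :
    volume (Prod.mk α ⁻¹' hitSet M ρ) = volume (torusBox ρ) :=
  (Measure.measurePreserving_sub_left volume (toTorus (M *ᵥ α))).measure_preimage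
    (isClosed_torusBox ρ).measurableSet.nullMeasurableSet

lemma twistedSet_eq (A : ℕ → Matrix (Fin d) (Fin d) ℤ) (r : Fin d → ℕ → ℝ) (α : Fin d → ℝ) :
    twistedSet A r α = toTorus ⁻¹' limsup (fun n =>
      Prod.mk α ⁻¹' hitSet (realMat (A (n + 1))) (fun i => r i (n + 1))) atTop ∩ unitCube d := by
  ext β
  rw [inter_comm]
  refine and_congr_right fun _ => ?_
  rw [mem_preimage, mem_limsup_iff_frequently_mem]
  -- Dropping the index `0`, where the radii are unconstrained, does not affect a limsup.
  conv_lhs => rw [← map_add_atTop_eq_nat 1, frequently_map]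
  simp only [memModOne_image_add_targetSet_iff]
  rfl

lemma volume_twistedSet (A : ℕ → Matrix (Fin d) (Fin d) ℤ) (r : Fin d → ℕ → ℝ) (α : Fin d → ℝ) :
    volume (twistedSet A r α) = volume (limsup (fun n =>
      Prod.mk α ⁻¹' hitSet (realMat (A (n + 1))) (fun i => r i (n + 1))) atTop) := by
  have hm : MeasurableSet (limsup (fun n =>
      Prod.mk α ⁻¹' hitSet (realMat (A (n + 1))) (fun i => r i (n + 1))) atTop) :=
    MeasurableSet.measurableSet_limsup fun n =>
      measurable_prodMk_left (measurableSet_hitSet _ _)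
  rw [twistedSet_eq, ← Measure.restrict_apply (continuous_toTorus.measurable hm),
    measurePreserving_toTorus.measure_preimage hm.nullMeasurableSet]

theorem volume_twistedSet_eq_zero (A : ℕ → Matrix (Fin d) (Fin d) ℤ) {r : Fin d → ℕ → ℝ}
    (hr : ∀ i n, 1 ≤ n → r i n ∈ Ioo (0 : ℝ) (1 / 2))
    (hsum : Summable fun n : ℕ => ∏ i, r i (n + 1)) (α : Fin d → ℝ) :
    volume (twistedSet A r α) = 0 := by
  rw [volume_twistedSet]
  refine measure_limsup_atTop_eq_zero ?_
  have h : ∀ n, volume (Prod.mk α ⁻¹' hitSet (realMat (A (n + 1))) (fun i => r i (n + 1)))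
      = ENNReal.ofReal (2 ^ d * ∏ i, r i (n + 1)) := by
    intro n
    rw [volume_preimage_hitSet, volume_torusBox fun i => hr i (n + 1) (by omega),
      Finset.prod_mul_distrib]
    simp
  simp_rw [h]
  exact (hsum.mul_left _).tsum_ofReal_ne_top

variable {μ : Measure (Fin d → ℝ)}

lemma measureReal_prod_eq_integral [IsProbabilityMeasure μ]
    {E : Set ((Fin d → ℝ) × UnitAddTorus (Fin d))} (hE : MeasurableSet E) :
    (μ.prod (volume : Measure (UnitAddTorus (Fin d)))).real E
      = ∫ α, volume.real (Prod.mk α ⁻¹' E) ∂μ := by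
  rw [measureReal_def, Measure.prod_apply hE]
  simp_rw [measureReal_def]
  rw [integral_toReal (measurable_measure_prodMk_left hE).aemeasurable
    (ae_of_all _ fun _ => measure_lt_top _ _)]

theorem ae_volume_twistedSet_eq_one (hd : 1 ≤ d) {r : Fin d → ℕ → ℝ}
    (hr : ∀ i n, 1 ≤ n → r i n ∈ Ioo (0 : ℝ) (1 / 2)) [IsProbabilityMeasure μ]
    {A : ℕ → Matrix (Fin d) (Fin d) ℤ} (hA_zero : A 0 = 1) {K : ℝ} (hK : 1 < K)
    (hA : ∀ n : ℕ, K ≤ smallestSingularValue (realMat (A (n + 1)) * (realMat (A n))⁻¹))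
    {s : ℝ} (hs : 2 < s)
    (hdecay : Asymptotics.IsBigO (comap (fun t : Fin d → ℝ => ‖t‖) atTop)
      (fourierTransform μ) (fun t : Fin d → ℝ => (Real.log ‖t‖) ^ (-s)))
    (hdiv : ¬ Summable fun n : ℕ => ∏ i, r i (n + 1)) :
    ∀ᵐ α ∂μ, volume (twistedSet A r α) = 1 := by
  have hA0 : realMat (A 0) = 1 := by simp [hA_zero, realMat]
  obtain ⟨c, hc, hgrowth⟩ :=
    exists_mul_pow_le_norm_vecMul (A := fun n => realMat (A n)) hd hK hA0 hA
  obtain ⟨C, hC0, hC⟩ := exists_norm_fourierTransform_le (by linarith) hdecay hc hK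
  set E : ℕ → Set ((Fin d → ℝ) × UnitAddTorus (Fin d)) := fun n =>
    hitSet (realMat (A (n + 1))) (fun i => r i (n + 1)) with hE
  have hEm : ∀ n, MeasurableSet (E n) := fun n => measurableSet_hitSet _ _
  have hEvol : ∀ n, (μ.prod volume).real (E n) = volume.real (torusBox fun i => r i (n + 1)) := by
    intro n
    rw [measureReal_prod_eq_integral (hEm n)]
    simp_rw [measureReal_def, hE, volume_preimage_hitSet]
    simp
  have key : ∀ᵐ p ∂μ.prod (volume : Measure (UnitAddTorus (Fin d))), ∃ᶠ n in atTop, p ∈ E n := by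
    refine ae_frequently_mem_of_correlation_le hEm
      (b := fun n => C * (((n + 1 : ℕ) : ℝ) + 1) ^ (-s)) (fun n => by positivity) ?_ ?_ ?_
    -- Since `E n` involves `A (n + 1)`, `n * b n ≤ C (n + 2)^(1 - s)`; this is where `s > 2`
    -- enters.
    · have h : Summable fun n : ℕ => C * ((n + 2 : ℕ) : ℝ) ^ (1 - s) :=
        ((summable_nat_add_iff 2).2 (Real.summable_nat_rpow.2 (by linarith))).mul_left C
      refine Summable.of_nonneg_of_le (fun n => by positivity) (fun n => ?_) h
      have h2 : ((n + 2 : ℕ) : ℝ) = ((n + 1 : ℕ) : ℝ) + 1 := by push_cast; ring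
      have h3 : (0 : ℝ) < ((n + 1 : ℕ) : ℝ) + 1 := by positivity
      rw [h2, sub_eq_add_neg, Real.rpow_add h3, Real.rpow_one, mul_left_comm]
      refine mul_le_mul_of_nonneg_left (mul_le_mul_of_nonneg_right ?_ (by positivity)) hC0
      push_cast
      linarith
    · intro m n hmn
      rw [hEvol, hEvol, measureReal_prod_eq_integral ((hEm m).inter (hEm n))]
      exact integral_volume_inter_le (isClosed_torusBox _).measurableSet
        (isClosed_torusBox _).measurableSet _ _
        (fun k hk => hC (n + 1) _ (hgrowth (m + 1) (n + 1) (by omega) k hk)) (by positivity)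
    · intro h
      refine hdiv ((h.mul_left ((2 ^ d)⁻¹)).congr fun n => ?_)
      have hpos : 0 ≤ ∏ i, 2 * r i (n + 1) :=
        Finset.prod_nonneg fun i _ => by linarith [(hr i (n + 1) (by omega)).1]
      rw [hEvol, measureReal_def, volume_torusBox fun i => hr i (n + 1) (by omega),
        ENNReal.toReal_ofReal hpos, Finset.prod_mul_distrib]
      simp
  filter_upwards [Measure.ae_ae_of_ae_prod key] with α hα
  rw [volume_twistedSet]
  have h : volume (univ : Set (UnitAddTorus (Fin d))) = 1 := measure_univ
  rw [← h]
  refine measure_congr (eventuallyEq_univ.2 ?_)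
  filter_upwards [hα] with y hy
  exact mem_limsup_iff_frequently_mem.2 hy

end Twisted

end TwistedApprox

theorem mainTheorem5 (d : ℕ) (hd : 1 ≤ d)
    (r : Fin d → ℕ → ℝ) (hr : ∀ i n, 1 ≤ n → r i n ∈ Set.Ioo (0 : ℝ) (1 / 2))
    (μ : MeasureTheory.Measure (Fin d → ℝ)) (hμ : MeasureTheory.IsProbabilityMeasure μ)
    (hμ_supp : μ (TwistedApprox.unitCube d) = 1)
    (A : ℕ → Matrix (Fin d) (Fin d) ℤ) (hA_zero : A 0 = 1)
    (K : ℝ) (hK : 1 < K)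
    (hA : ∀ n : ℕ, K ≤ TwistedApprox.smallestSingularValue
      (TwistedApprox.realMat (A (n + 1)) * (TwistedApprox.realMat (A n))⁻¹))
    (s : ℝ) (hs : (d : ℝ) + 1 < s)
    -- the norm on `Fin d → ℝ` is the maximum norm
    (hdecay : Asymptotics.IsBigO (Filter.comap (fun t : Fin d → ℝ => ‖t‖) Filter.atTop)
      (TwistedApprox.fourierTransform μ) (fun t : Fin d → ℝ => (Real.log ‖t‖) ^ (-s))) :
    ∀ᵐ α ∂μ,
      ((Summable fun n : ℕ => ∏ i, r i (n + 1)) →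
        MeasureTheory.volume (TwistedApprox.twistedSet A r α) = 0) ∧
      ((¬ Summable fun n : ℕ => ∏ i, r i (n + 1)) →
        MeasureTheory.volume (TwistedApprox.twistedSet A r α) = 1) := by
  have hd' : (1 : ℝ) ≤ d := by exact_mod_cast hd
  by_cases hsum : Summable fun n : ℕ => ∏ i, r i (n + 1)
  · exact MeasureTheory.ae_of_all _ fun α =>
      ⟨fun _ => TwistedApprox.volume_twistedSet_eq_zero A hr hsum α, fun h => absurd hsum h⟩
  · filter_upwards [TwistedApprox.ae_volume_twistedSet_eq_one hd hr hA_zero hK hA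
      (by linarith : (2 : ℝ) < s) hdecay hsum] with α hα
    exact ⟨fun h => absurd h hsum, fun _ => hα⟩
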